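/- Let $n\ge 4$ and $K_1=\mathbb{Q}(q)$, with $q$ an indeterminate. Let $\mathscr{H}=\mathscr{H}_{K_1,B_n}(1,q)$ be the Iwahori–Hecke algebra of type $B_n$ with parameters $u=1$ and $q$, that is, the $K_1$-algebra with generators $a_1,\dots,a_n$ and relations $a_1^2=1$; $a_i^2=(q-1)a_i+q$ for $i\ge 2$; $a_1a_2a_1a_2=a_2a_1a_2a_1$; $a_ia_{i+1}a_i=a_{i+1}a_ia_{i+1}$ for $2\le i\le n-1$; $a_ia_j=a_ja_i$ for $|i-j|>1$. Let $\sharp,\flat,\natural$ be the involutive algebra automorphisms of $\mathscr{H}$ given by $$a_1^\sharp=-a_1,\ a_i^\sharp=a_i;\qquad a_1^\flat=a_1,\ a_i^\flat=(q-1)-a_i;\qquad a_1^\natural=-a_1,\ a_i^\natural=(q-1)-a_i\qquad(i\ge 2),$$ and let $\mathscr{H}^\dagger=\{h\in\mathscr{H}\mid h^\sharp=h^\flat=h^\natural=h\}$ be the intersection of their fixed subalgebras. For a pair $\lambda=(\lambda^{(1)},\lambda^{(2)})$ of Young diagrams of total size $n$, let $V_\lambda$ be the $K_1$-vector space with basis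 $v_T$, where $T=(T^{(1)},T^{(2)})$ runs over the standard tableaux of shape $\lambda$ (each of $1,\dots,n$ appears exactly once in $T$, and the entries increase along the rows and columns of both diagrams). Let $\rho_T(k)\in\{1,2\}$ be the index of the diagram containing $k$, put $u_1=1$, $u_2=-1$, and for $k$ in row $i$ and column $j$ and $l$ in row $i'$ and column $j'$ put $d_{T,k,l}=(j'-i')-(j-i)$. The seminormal form representation $\pi_\lambda$ of $\mathscr{H}$ on $V_\lambda$ is given by $a_1v_T=u_{\rho_T(1)}v_T$ and, for $i\ge2$: $a_iv_T=qv_T$ if $i-1,i$ are in the same row of the same diagram; $a_iv_T=-v_T$ if they are in the same column of the same diagram; and otherwise, with $T_1$ obtained from $T$ by exchanging $i-1$ and $i$, $$a_i\langle v_T,v_{T_1}\rangle=\langle v_T,v_{T_1}\rangle\,M\Big(d_{T,i,i-1},\frac{u_{\rho_T(i-1)}}{u_{\rho_T(i)}}\Big),\qquad M(k,y)=\frac1{1-q^ky}\begin{bmatrix}q-1&1-q^{k+1}y\\ q(1-q^{k-1}y)&-q^ky(q-1)\end{bmatrix}.$$ Let $\pi_{\lambda,\dagger}$ be the restriction of $\pi_\lambda$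 to $\mathscr{H}^\dagger$. Write $\lambda^*=(\lambda^{(2)},\lambda^{(1)})$, $\lambda'=(\lambda^{(1)\prime},\lambda^{(2)\prime})$ and $\lambda'^*=(\lambda^{(2)\prime},\lambda^{(1)\prime})$, where $\lambda^{(k)\prime}$ is the transpose of $\lambda^{(k)}$. Then, as representations of $\mathscr{H}^\dagger$ over $K_1$, $$\pi_{\lambda,\dagger}\cong\pi_{\lambda^*,\dagger}\cong\pi_{\lambda',\dagger}\cong\pi_{\lambda'^*,\dagger}.$$ -/

import Mathlib

/-! ### Iwahori-Hecke algebras of type `B` -/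

/-- The elements `f 0, f 1, …` of the `R`-algebra `A` satisfy the defining relations of the generators
`a₁, a₂, …, aₙ` of the Iwahori-Hecke algebra of type `Bₙ` with parameters `u, q`.
The index `i : Fin n` stands for the generator `a_{i+1}`. -/
structure IsHeckeBFamily {R : Type*} [CommRing R] {n : ℕ} (u q : R) {A : Type*} [Ring A]
    [Algebra R A] (f : Fin n → A) : Prop where
  quad_zero : ∀ i : Fin n, (i : ℕ) = 0 → f i * f i = (u - 1) • f i + u • (1 : A)
  quad : ∀ i : Fin n, (i : ℕ) ≠ 0 → f i * f i = (q - 1) • f i + q • (1 : A)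
  braid_four : ∀ i j : Fin n, (i : ℕ) = 0 → (j : ℕ) = 1 →
    f i * f j * f i * f j = f j * f i * f j * f i
  braid_three : ∀ i j : Fin n, (i : ℕ) ≠ 0 → (j : ℕ) = i + 1 →
    f i * f j * f i = f j * f i * f j
  comm : ∀ i j : Fin n, (i : ℕ) + 1 < j → f i * f j = f j * f i

/-- The same relations, as a relation on the free algebra on `n` generators. -/
inductive HeckeBRel {R : Type*} [CommRing R] (n : ℕ) (u q : R) :
    FreeAlgebra R (Fin n) → FreeAlgebra R (Fin n) → Prop
  | quad_zero (i : Fin n) (hi : (i : ℕ) = 0) :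
      HeckeBRel n u q (FreeAlgebra.ι R i * FreeAlgebra.ι R i)
        ((u - 1) • FreeAlgebra.ι R i + u • (1 : FreeAlgebra R (Fin n)))
  | quad (i : Fin n) (hi : (i : ℕ) ≠ 0) :
      HeckeBRel n u q (FreeAlgebra.ι R i * FreeAlgebra.ι R i)
        ((q - 1) • FreeAlgebra.ι R i + q • (1 : FreeAlgebra R (Fin n)))
  | braid_four (i j : Fin n) (hi : (i : ℕ) = 0) (hj : (j : ℕ) = 1) :
      HeckeBRel n u q
        (FreeAlgebra.ι R i * FreeAlgebra.ι R j * FreeAlgebra.ι R i * FreeAlgebra.ι R j)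
        (FreeAlgebra.ι R j * FreeAlgebra.ι R i * FreeAlgebra.ι R j * FreeAlgebra.ι R i)
  | braid_three (i j : Fin n) (hi : (i : ℕ) ≠ 0) (hj : (j : ℕ) = i + 1) :
      HeckeBRel n u q
        (FreeAlgebra.ι R i * FreeAlgebra.ι R j * FreeAlgebra.ι R i)
        (FreeAlgebra.ι R j * FreeAlgebra.ι R i * FreeAlgebra.ι R j)
  | comm (i j : Fin n) (hij : (i : ℕ) + 1 < j) :
      HeckeBRel n u q (FreeAlgebra.ι R i * FreeAlgebra.ι R j)
        (FreeAlgebra.ι R j * FreeAlgebra.ι R i)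

/-- The Iwahori-Hecke algebra `ℋ_{R,Bₙ}(u,q)`, by generators and relations. -/
abbrev HeckeB {R : Type*} [CommRing R] (n : ℕ) (u q : R) : Type _ :=
  RingQuot (HeckeBRel n u q)

/-- The generator `a_{i+1}` of `ℋ_{R,Bₙ}(u,q)`. -/
noncomputable def HeckeB.gen {R : Type*} [CommRing R] {n : ℕ} (u q : R) (i : Fin n) :
    HeckeB n u q :=
  RingQuot.mkAlgHom R (HeckeBRel n u q) (FreeAlgebra.ι R i)

theorem HeckeB.isHeckeBFamily_gen {R : Type*} [CommRing R] {n : ℕ} (u q : R) :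
    IsHeckeBFamily u q (HeckeB.gen (n := n) u q) where
  quad_zero i hi := by
    simpa only [map_mul, map_add, map_smul, map_one, HeckeB.gen] using
      RingQuot.mkAlgHom_rel R (HeckeBRel.quad_zero (u := u) (q := q) i hi)
  quad i hi := by
    simpa only [map_mul, map_add, map_smul, map_one, HeckeB.gen] using
      RingQuot.mkAlgHom_rel R (HeckeBRel.quad (u := u) (q := q) i hi)
  braid_four i j hi hj := by
    simpa only [map_mul, HeckeB.gen] using
      RingQuot.mkAlgHom_rel R (HeckeBRel.braid_four (u := u) (q := q) i j hi hj)
  braid_three i j hi hj := by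
    simpa only [map_mul, HeckeB.gen] using
      RingQuot.mkAlgHom_rel R (HeckeBRel.braid_three (u := u) (q := q) i j hi hj)
  comm i j hij := by
    simpa only [map_mul, HeckeB.gen] using
      RingQuot.mkAlgHom_rel R (HeckeBRel.comm (u := u) (q := q) i j hij)

/-- The algebra homomorphism with `a_{i+1} ↦ f i`, for `f` satisfying the defining relations. -/
noncomputable def HeckeB.lift {R : Type*} [CommRing R] {n : ℕ} {u q : R} {A : Type*} [Ring A]
    [Algebra R A] {f : Fin n → A} (hf : IsHeckeBFamily u q f) : HeckeB n u q →ₐ[R] A :=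
  RingQuot.liftAlgHom R ⟨FreeAlgebra.lift R f, by
    intro x y h
    induction h with
    | quad_zero i hi => simpa using hf.quad_zero i hi
    | quad i hi => simpa using hf.quad i hi
    | braid_four i j hi hj => simpa using hf.braid_four i j hi hj
    | braid_three i j hi hj => simpa using hf.braid_three i j hi hj
    | comm i j hij => simpa using hf.comm i j hij⟩

theorem HeckeB.lift_gen {R : Type*} [CommRing R] {n : ℕ} {u q : R} {A : Type*} [Ring A]
    [Algebra R A] {f : Fin n → A} (hf : IsHeckeBFamily u q f) (i : Fin n) :
    HeckeB.lift hf (HeckeB.gen u q i) = f i := by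
  simp [HeckeB.lift, HeckeB.gen]

theorem HeckeB.hom_ext {R : Type*} [CommRing R] {n : ℕ} {u q : R} {A : Type*} [Ring A]
    [Algebra R A] {φ ψ : HeckeB n u q →ₐ[R] A}
    (h : ∀ i : Fin n, φ (HeckeB.gen u q i) = ψ (HeckeB.gen u q i)) : φ = ψ := by
  apply RingQuot.ringQuot_ext'
  apply FreeAlgebra.hom_ext
  funext i
  exact h i

/-! ### The three involutions of `ℋ_{R,Bₙ}(1,q)` and the intersection of their fixed algebras -/

theorem IsHeckeBFamily.sharp {R : Type*} [CommRing R] {n : ℕ} {q : R} {A : Type*} [Ring A]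
    [Algebra R A] {f : Fin n → A} (hf : IsHeckeBFamily 1 q f) :
    IsHeckeBFamily 1 q (fun i : Fin n => if (i : ℕ) = 0 then -f i else f i) where
  quad_zero i hi := by
    have := hf.quad_zero i hi
    simpa [hi] using this
  quad i hi := by
    have := hf.quad i hi
    simpa [hi] using this
  braid_four i j hi hj := by
    have := hf.braid_four i j hi hj
    simpa [hi, hj] using this
  braid_three i j hi hj := by
    have := hf.braid_three i j hi hj
    simpa [hi, hj] using this
  comm i j hij := by
    have := hf.comm i j hij
    have hj : (j : ℕ) ≠ 0 := by omega
    by_cases hi : (i : ℕ) = 0 <;> simpa [hi, hj] using this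

theorem IsHeckeBFamily.flat {R : Type*} [CommRing R] {n : ℕ} {q : R} {A : Type*} [Ring A]
    [Algebra R A] {f : Fin n → A} (hf : IsHeckeBFamily 1 q f) :
    IsHeckeBFamily 1 q
      (fun i : Fin n => if (i : ℕ) = 0 then f i else (q - 1) • (1 : A) - f i) where
  quad_zero i hi := by
    have := hf.quad_zero i hi
    simpa [hi] using this
  quad i hi := by
    have := hf.quad i hi
    simp only [hi, if_false, sub_mul, mul_sub, smul_mul_assoc, mul_smul_comm, one_mul, mul_one,
      this]
    module
  braid_four i j hi hj := by
    have h1 := hf.braid_four i j hi hj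
    have h2 := hf.quad_zero i hi
    have hj' : (j : ℕ) ≠ 0 := by omega
    simp only [sub_self, zero_smul, one_smul, zero_add] at h2
    simp only [hi, hj', if_true, if_false, sub_mul, mul_sub, smul_mul_assoc, mul_smul_comm,
      one_mul, mul_one, h2, h1]
    have h3 : f j * f i * f i = f j := by rw [mul_assoc, h2, mul_one]
    simp only [h3]
    module
  braid_three i j hi hj := by
    have h1 := hf.braid_three i j hi hj
    have h2 := hf.quad i hi
    have hj' : (j : ℕ) ≠ 0 := by omega
    have h3 := hf.quad j hj'
    simp only [hi, hj', if_false, sub_mul, mul_sub, smul_mul_assoc, mul_smul_comm,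
      one_mul, mul_one, h2, h3, h1]
    module
  comm i j hij := by
    have h1 := hf.comm i j hij
    have hj : (j : ℕ) ≠ 0 := by omega
    by_cases hi : (i : ℕ) = 0
    · simp only [hi, hj, if_true, if_false, sub_mul, mul_sub, smul_mul_assoc, mul_smul_comm,
        one_mul, mul_one, h1]
    · simp only [hi, hj, if_false, sub_mul, mul_sub, smul_mul_assoc, mul_smul_comm,
        one_mul, mul_one, h1]
      module

theorem IsHeckeBFamily.natural {R : Type*} [CommRing R] {n : ℕ} {q : R} {A : Type*} [Ring A]
    [Algebra R A] {f : Fin n → A} (hf : IsHeckeBFamily 1 q f) :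
    IsHeckeBFamily 1 q
      (fun i : Fin n => if (i : ℕ) = 0 then -f i else (q - 1) • (1 : A) - f i) := by
  convert hf.flat.sharp using 2 with i
  by_cases hi : (i : ℕ) = 0 <;> simp [hi]

/-- The involution `♯`: `a₁ ↦ -a₁`, and `aᵢ ↦ aᵢ` for `i ≥ 2`. -/
noncomputable def HeckeB.sharp {R : Type*} [CommRing R] (n : ℕ) (q : R) :
    HeckeB n (1 : R) q →ₐ[R] HeckeB n (1 : R) q :=
  HeckeB.lift (HeckeB.isHeckeBFamily_gen (1 : R) q).sharp

/-- The involution `♭`: `a₁ ↦ a₁`, and `aᵢ ↦ (q - 1) - aᵢ` for `i ≥ 2`. -/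
noncomputable def HeckeB.flat {R : Type*} [CommRing R] (n : ℕ) (q : R) :
    HeckeB n (1 : R) q →ₐ[R] HeckeB n (1 : R) q :=
  HeckeB.lift (HeckeB.isHeckeBFamily_gen (1 : R) q).flat

/-- The Goldman involution `♮`: `a₁ ↦ -a₁`, and `aᵢ ↦ (q - 1) - aᵢ` for `i ≥ 2`. -/
noncomputable def HeckeB.natural {R : Type*} [CommRing R] (n : ℕ) (q : R) :
    HeckeB n (1 : R) q →ₐ[R] HeckeB n (1 : R) q :=
  HeckeB.lift (HeckeB.isHeckeBFamily_gen (1 : R) q).natural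

/-- The subalgebra of the elements fixed by an algebra endomorphism. -/
def fixedSubalgebra {R : Type*} [CommRing R] {A : Type*} [Ring A] [Algebra R A]
    (φ : A →ₐ[R] A) : Subalgebra R A :=
  AlgHom.equalizer φ (AlgHom.id R A)

/-- The intersection `ℋ†` of the fixed subalgebras of `♯`, `♭` and `♮` in `ℋ_{R,Bₙ}(1,q)`. -/
noncomputable def HeckeB.dagger {R : Type*} [CommRing R] (n : ℕ) (q : R) :
    Subalgebra R (HeckeB n (1 : R) q) :=
  fixedSubalgebra (HeckeB.sharp n q) ⊓ fixedSubalgebra (HeckeB.flat n q) ⊓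
    fixedSubalgebra (HeckeB.natural n q)

/-! ### Bipartitions and standard tableaux -/

/-- A `2`-tuple of Young diagrams of total size `n`. -/
structure BiPartition (n : ℕ) where
  shape : Fin 2 → YoungDiagram
  size : (shape 0).card + (shape 1).card = n

/-- `λ* = (λ⁽²⁾, λ⁽¹⁾)`. -/
def BiPartition.star {n : ℕ} (lam : BiPartition n) : BiPartition n where
  shape := ![lam.shape 1, lam.shape 0]
  size := by simpa [add_comm] using lam.size

theorem YoungDiagram.card_transpose_eq (μ : YoungDiagram) : μ.transpose.card = μ.card := by
  simp [YoungDiagram.card, YoungDiagram.transpose]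

/-- `λ' = (λ⁽¹⁾', λ⁽²⁾')`, the transpose of each of the two diagrams. -/
def BiPartition.transpose {n : ℕ} (lam : BiPartition n) : BiPartition n where
  shape := fun α => (lam.shape α).transpose
  size := by simpa [YoungDiagram.card_transpose_eq] using lam.size

/-- The boxes of the two diagrams; rows and columns are counted from `0`. -/
@[ext]
structure BiPartition.Box {n : ℕ} (lam : BiPartition n) where
  comp : Fin 2
  row : ℕ
  col : ℕ
  mem : (row, col) ∈ lam.shape comp

/-- A filling of the boxes by `n` symbols, each used once, is standard if it increases along the
rows and down the columns of both diagrams. The symbol `k : Fin n` stands for the number `k + 1`. -/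
def BiPartition.IsStandard {n : ℕ} {lam : BiPartition n} (e : lam.Box ≃ Fin n) : Prop :=
  ∀ b c : lam.Box, b.comp = c.comp →
    (b.row = c.row → b.col < c.col → e b < e c) ∧ (b.col = c.col → b.row < c.row → e b < e c)

/-- The standard tableaux of shape `λ`. -/
abbrev BiPartition.STab {n : ℕ} (lam : BiPartition n) : Type :=
  {e : lam.Box ≃ Fin n // BiPartition.IsStandard e}

/-- The box in which the symbol `k` is placed. -/
def BiPartition.STab.pos {n : ℕ} {lam : BiPartition n} (T : lam.STab) (k : Fin n) : lam.Box :=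
  T.1.symm k

/-- `j - i` for the box in row `i` and column `j`. -/
def BiPartition.Box.content {n : ℕ} {lam : BiPartition n} (b : lam.Box) : ℤ :=
  (b.col : ℤ) - (b.row : ℤ)

/-- The axial distance `d_{T,k,l}` from `k` to `l` in `T`. -/
def BiPartition.STab.axialDist {n : ℕ} {lam : BiPartition n} (T : lam.STab) (k l : Fin n) : ℤ :=
  (T.pos l).content - (T.pos k).content

/-- The two boxes lie in the same row of the same diagram. -/
abbrev BiPartition.Box.SameRow {n : ℕ} {lam : BiPartition n} (b c : lam.Box) : Prop :=
  b.comp = c.comp ∧ b.row = c.row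

/-- The two boxes lie in the same column of the same diagram. -/
abbrev BiPartition.Box.SameCol {n : ℕ} {lam : BiPartition n} (b c : lam.Box) : Prop :=
  b.comp = c.comp ∧ b.col = c.col

/-- The symbol before `i` (for `i ≠ 0`). -/
def prevSymbol {n : ℕ} (i : Fin n) : Fin n :=
  ⟨(i : ℕ) - 1, lt_of_le_of_lt (Nat.sub_le _ _) i.isLt⟩

/-- The filling with the symbols `i - 1` and `i` exchanged. -/
def BiPartition.swapFilling {n : ℕ} {lam : BiPartition n} (i : Fin n) (e : lam.Box ≃ Fin n) :
    lam.Box ≃ Fin n :=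
  e.trans (Equiv.swap (prevSymbol i) i)

theorem swap_prevSymbol_lt {n : ℕ} {i x y : Fin n} (hxy : x < y)
    (h : ¬ (x = prevSymbol i ∧ y = i)) :
    Equiv.swap (prevSymbol i) i x < Equiv.swap (prevSymbol i) i y := by
  simp only [Equiv.swap_apply_def, prevSymbol, Fin.ext_iff, Fin.lt_def] at *
  split_ifs <;> first | omega | (dsimp only; omega)

theorem BiPartition.isStandard_swapFilling {n : ℕ} {lam : BiPartition n} {e : lam.Box ≃ Fin n}
    (he : BiPartition.IsStandard e) {i : Fin n}
    (hr : ¬ (e.symm (prevSymbol i)).SameRow (e.symm i))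
    (hc : ¬ (e.symm (prevSymbol i)).SameCol (e.symm i)) :
    BiPartition.IsStandard (BiPartition.swapFilling i e) := by
  intro b c hbc
  refine ⟨fun h1 h2 => ?_, fun h1 h2 => ?_⟩
  · refine swap_prevSymbol_lt ((he b c hbc).1 h1 h2) ?_
    rintro ⟨h3, h4⟩
    apply hr
    rw [← h3, ← h4]
    simp only [Equiv.symm_apply_apply]
    exact ⟨hbc, h1⟩
  · refine swap_prevSymbol_lt ((he b c hbc).2 h1 h2) ?_
    rintro ⟨h3, h4⟩
    apply hc
    rw [← h3, ← h4]
    simp only [Equiv.symm_apply_apply]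
    exact ⟨hbc, h1⟩

/-- The standard tableau obtained from `T` by exchanging the symbols `i - 1` and `i`, when these
are neither in the same row nor in the same column of the same diagram. -/
def BiPartition.STab.swap {n : ℕ} {lam : BiPartition n} (T : lam.STab) (i : Fin n)
    (hr : ¬ (T.pos (prevSymbol i)).SameRow (T.pos i))
    (hc : ¬ (T.pos (prevSymbol i)).SameCol (T.pos i)) : lam.STab :=
  ⟨BiPartition.swapFilling i T.1, BiPartition.isStandard_swapFilling T.2 hr hc⟩

/-! ### The seminormal action of the generators, for `u = 1`, over `K₁ = ℚ(q)` -/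

/-- The field `ℚ(q)`. -/
def K1 : Type := RatFunc ℚ

noncomputable instance : Field K1 := inferInstanceAs (Field (RatFunc ℚ))

instance : CharZero K1 := inferInstanceAs (CharZero (RatFunc ℚ))

/-- The indeterminate `q`. -/
noncomputable def qq : K1 := (RatFunc.X : RatFunc ℚ)

/-- `u₁ = u = 1` and `u₂ = -1`. -/
noncomputable def uVal (α : Fin 2) : K1 := ![1, -1] α

/-- The matrix `M(k, y)`. -/
noncomputable def seminormalMatrix (k : ℤ) (y : K1) : Matrix (Fin 2) (Fin 2) K1 :=
  (1 / (1 - qq ^ k * y)) •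
    !![qq - 1, 1 - qq ^ (k + 1) * y; qq * (1 - qq ^ (k - 1) * y), -(qq ^ k * y * (qq - 1))]

/-- `M(-k, 1/y)` is `M(k, y)` with both the rows and the columns exchanged: the actions that the
matrices attached to `T` and to `s T` prescribe on the span of `v_T, v_{s T}` agree. -/
theorem seminormalMatrix_neg_inv {k : ℤ} {y : K1} (hy : y ≠ 0) (hd : 1 - qq ^ k * y ≠ 0)
    (i j : Fin 2) :
    seminormalMatrix (-k) y⁻¹ i j = seminormalMatrix k y (1 - i) (1 - j) := by
  have hq : qq ≠ 0 := (RatFunc.X_ne_zero : (RatFunc.X : RatFunc ℚ) ≠ 0)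
  have hz : qq ^ k * y ≠ 0 := mul_ne_zero (zpow_ne_zero k hq) hy
  have h0 : qq ^ (-k) * y⁻¹ = (qq ^ k * y)⁻¹ := by rw [zpow_neg, mul_inv]
  have h1 : qq ^ (-k + 1) * y⁻¹ = qq * (qq ^ k * y)⁻¹ := by
    rw [zpow_add_one₀ hq, ← h0]; ring
  have h2 : qq ^ (-k - 1) * y⁻¹ = (qq ^ k * y)⁻¹ * qq⁻¹ := by
    rw [zpow_sub_one₀ hq, ← h0]; ring
  have h3 : qq ^ (k + 1) * y = qq * (qq ^ k * y) := by rw [zpow_add_one₀ hq]; ring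
  have h4 : qq ^ (k - 1) * y = (qq ^ k * y) * qq⁻¹ := by rw [zpow_sub_one₀ hq]; ring
  simp only [seminormalMatrix, Matrix.smul_apply, h0, h1, h2, h3, h4, smul_eq_mul]
  generalize qq ^ k * y = z at *
  have hd' : z - 1 ≠ 0 := fun h => hd (by linear_combination -h)
  fin_cases i <;> fin_cases j <;> simp <;> field_simp <;> grind

/-- The space `V_λ` with basis `v_T`, `T` a standard tableau of shape `λ`. -/
abbrev BiPartition.V {n : ℕ} (lam : BiPartition n) : Type := lam.STab →₀ K1

/-- The basis vector `v_T`. -/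
noncomputable def BiPartition.STab.vec {n : ℕ} {lam : BiPartition n} (T : lam.STab) : lam.V :=
  Finsupp.single T 1

/-- The matrix `M(d_{T,i,i-1}, u_{ρ_T(i-1)} / u_{ρ_T(i)})`. -/
noncomputable def BiPartition.STab.mat {n : ℕ} {lam : BiPartition n} (T : lam.STab) (i : Fin n) :
    Matrix (Fin 2) (Fin 2) K1 :=
  seminormalMatrix (T.axialDist i (prevSymbol i))
    (uVal (T.pos (prevSymbol i)).comp / uVal (T.pos i).comp)

/-- The vector `aᵢ v_T`. In the last case `aᵢ` acts on the span of `v_T, v_{s T}` (in this order) by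
the matrix `M` attached to `T`, so that `aᵢ v_T` is given by its first column. -/
noncomputable def BiPartition.STab.act {n : ℕ} {lam : BiPartition n} (T : lam.STab) (i : Fin n) :
    lam.V :=
  if (i : ℕ) = 0 then uVal (T.pos i).comp • T.vec
  else if hr : (T.pos (prevSymbol i)).SameRow (T.pos i) then qq • T.vec
  else if hc : (T.pos (prevSymbol i)).SameCol (T.pos i) then -T.vec
  else T.mat i 0 0 • T.vec + T.mat i 1 0 • (T.swap i hr hc).vec

/-- The action of the generator `aᵢ` on `V_λ`, extended linearly. -/
noncomputable def BiPartition.genAction {n : ℕ} (lam : BiPartition n) (i : Fin n) :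
    Module.End K1 lam.V :=
  Finsupp.linearCombination K1 (fun T : lam.STab => T.act i)

/-! ### The generators act through the Hecke algebra -/

theorem qq_ne_zero : qq ≠ 0 := (RatFunc.X_ne_zero : (RatFunc.X : RatFunc ℚ) ≠ 0)

theorem intDegree_X_pow (k : ℕ) : ((RatFunc.X : RatFunc ℚ) ^ k).intDegree = k := by
  induction k with
  | zero => simp
  | succ k ih =>
    rw [pow_succ, RatFunc.intDegree_mul (pow_ne_zero _ RatFunc.X_ne_zero) RatFunc.X_ne_zero, ih]
    simp

theorem qq_pow_eq {m : ℕ} {s : K1} (hs : s = 1 ∨ s = -1) (h : qq ^ m = s) : m = 0 := by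
  have h2 : (RatFunc.X : RatFunc ℚ) ^ m = 1 ∨ (RatFunc.X : RatFunc ℚ) ^ m = -1 := by
    rcases hs with rfl | rfl
    · exact Or.inl h
    · exact Or.inr h
  have h3 := intDegree_X_pow m
  rcases h2 with h2 | h2 <;> rw [h2] at h3 <;> simp at h3 <;> omega

theorem qq_zpow_inj {k l : ℤ} {s : K1} (hs : s = 1 ∨ s = -1) (h : qq ^ k = s * qq ^ l) :
    k = l := by
  wlog hkl : l ≤ k generalizing k l
  · refine (this (k := l) (l := k) ?_ (by omega)).symm
    rcases hs with rfl | rfl <;> simp [h]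
  obtain ⟨m, hm⟩ := Int.eq_ofNat_of_zero_le (sub_nonneg.mpr hkl)
  obtain rfl : k = l + m := by omega
  rw [zpow_add₀ qq_ne_zero, zpow_natCast, mul_comm] at h
  have h2 := mul_right_cancel₀ (zpow_ne_zero l qq_ne_zero) h
  have h3 := qq_pow_eq hs h2
  omega

theorem uVal_cases (α : Fin 2) : uVal α = 1 ∨ uVal α = -1 := by
  fin_cases α <;> simp [uVal]

theorem uVal_eq_or (α β : Fin 2) : α = β ∨ uVal β = -uVal α := by
  fin_cases α <;> fin_cases β <;> simp [uVal]

theorem neg_one_ne_one_K1 : (-1 : K1) ≠ 1 := by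
  intro h
  have h2 : (2 : K1) = 0 := by linear_combination -h
  exact two_ne_zero h2

namespace BiPartition

variable {n : ℕ} {lam : BiPartition n}

/-- `u_{ρ} q^{content}` of a box. -/
noncomputable def Box.wt (b : lam.Box) : K1 := uVal b.comp * qq ^ b.content

theorem Box.wt_ne_zero (b : lam.Box) : b.wt ≠ 0 := by
  refine mul_ne_zero ?_ (zpow_ne_zero _ qq_ne_zero)
  rcases uVal_cases b.comp with h | h <;> simp [h]

theorem Box.eq_of_wt_eq {b c : lam.Box} (h : b.wt = c.wt) :
    b.comp = c.comp ∧ b.content = c.content := by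
  have hb := uVal_cases b.comp
  have hc := uVal_cases c.comp
  have hcont : b.content = c.content := by
    simp only [Box.wt] at h
    rcases hb with hb | hb <;> rcases hc with hc | hc <;> rw [hb, hc] at h
    · exact qq_zpow_inj (Or.inl rfl) (by simpa using h)
    · exact qq_zpow_inj (Or.inr rfl) (by simpa using h)
    · exact qq_zpow_inj (Or.inr rfl) (by linear_combination -h)
    · exact qq_zpow_inj (Or.inl rfl) (by linear_combination -h)
  refine ⟨?_, hcont⟩
  simp only [Box.wt, hcont] at h
  have h2 := mul_right_cancel₀ (zpow_ne_zero _ qq_ne_zero) h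
  by_contra hne
  rcases uVal_eq_or b.comp c.comp with h3 | h3
  · exact hne h3
  · rw [h3] at h2
    rcases hb with hb | hb <;> rw [hb] at h2
    · exact neg_one_ne_one_K1 h2.symm
    · exact neg_one_ne_one_K1 (by simpa using h2)

theorem IsStandard.lt {e : lam.Box ≃ Fin n} (he : IsStandard e) {b c : lam.Box}
    (h : b.comp = c.comp) (hr : b.row ≤ c.row) (hc : b.col ≤ c.col) (hne : b ≠ c) :
    e b < e c := by
  let d : lam.Box := ⟨c.comp, b.row, c.col, (lam.shape c.comp).up_left_mem hr le_rfl c.mem⟩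
  rcases hc.eq_or_lt with hc1 | hc1
  · refine (he b c h).2 hc1 (lt_of_le_of_ne hr fun h2 => hne ?_)
    exact Box.ext h h2 hc1
  · have h1 : e b < e d := (he b d h).1 rfl hc1
    rcases hr.eq_or_lt with hr1 | hr1
    · have : d = c := Box.ext rfl hr1 rfl
      rwa [this] at h1
    · exact h1.trans ((he d c rfl).2 rfl hr1)

theorem IsStandard.wt_ne {e : lam.Box ≃ Fin n} (he : IsStandard e) {k l : Fin n}
    (hkl : k < l) (hl : (l : ℕ) ≤ k + 2) : (e.symm k).wt ≠ (e.symm l).wt := by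
  intro hw
  obtain ⟨hcomp, hcont⟩ := Box.eq_of_wt_eq hw
  obtain ⟨b, rfl⟩ := e.surjective k
  obtain ⟨c, rfl⟩ := e.surjective l
  simp only [Equiv.symm_apply_apply] at hcomp hcont
  have hne : b ≠ c := by rintro rfl; exact lt_irrefl _ hkl
  simp only [Box.content] at hcont
  have hrow : b.row < c.row := by
    by_contra hcon
    have := he.lt hcomp.symm (by omega) (by omega) hne.symm
    exact absurd hkl this.asymm
  have hcol : b.col < c.col := by omega
  let d1 : lam.Box :=
    ⟨c.comp, b.row, c.col, (lam.shape c.comp).up_left_mem hrow.le le_rfl c.mem⟩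
  let d2 : lam.Box :=
    ⟨c.comp, c.row, b.col, (lam.shape c.comp).up_left_mem le_rfl hcol.le c.mem⟩
  have h1 : e b < e d1 := (he b d1 hcomp).1 rfl hcol
  have h2 : e d1 < e c := (he d1 c rfl).2 rfl hrow
  have h3 : e b < e d2 := (he b d2 hcomp).2 rfl hrow
  have h4 : e d2 < e c := (he d2 c rfl).1 rfl hcol
  have h5 : e d1 ≠ e d2 := by
    intro h
    have := congrArg Box.row (e.injective h)
    exact hrow.ne this
  simp only [Fin.lt_def, ne_eq, Fin.ext_iff] at *
  omega

theorem IsStandard.content_of_sameRow {e : lam.Box ≃ Fin n} (he : IsStandard e) {b c : lam.Box}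
    (h : (e c : ℕ) = e b + 1) (hr : b.SameRow c) : c.content = b.content + 1 := by
  obtain ⟨h1, h2⟩ := hr
  have hne : b ≠ c := by rintro rfl; omega
  have hlt : b.col < c.col := by
    by_contra hcon
    have := he.lt h1.symm h2.symm.le (by omega) hne.symm
    rw [Fin.lt_def] at this
    omega
  have heq : c.col = b.col + 1 := by
    by_contra hcon
    let d : lam.Box := ⟨c.comp, c.row, b.col + 1,
      (lam.shape c.comp).up_left_mem le_rfl (by omega) c.mem⟩
    have h3 : e b < e d := (he b d h1).1 h2 (Nat.lt_succ_self _)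
    have h4 : e d < e c := (he d c rfl).1 rfl (by simp only [d]; omega)
    simp only [Fin.lt_def] at *
    omega
  simp only [Box.content]
  omega

theorem IsStandard.content_of_sameCol {e : lam.Box ≃ Fin n} (he : IsStandard e) {b c : lam.Box}
    (h : (e c : ℕ) = e b + 1) (hr : b.SameCol c) : c.content = b.content - 1 := by
  obtain ⟨h1, h2⟩ := hr
  have hne : b ≠ c := by rintro rfl; omega
  have hlt : b.row < c.row := by
    by_contra hcon
    have := he.lt h1.symm (by omega) h2.symm.le hne.symm
    rw [Fin.lt_def] at this
    omega
  have heq : c.row = b.row + 1 := by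
    by_contra hcon
    let d : lam.Box := ⟨c.comp, b.row + 1, c.col,
      (lam.shape c.comp).up_left_mem (by omega) le_rfl c.mem⟩
    have h3 : e b < e d := (he b d h1).2 h2 (Nat.lt_succ_self _)
    have h4 : e d < e c := (he d c rfl).2 rfl (by simp only [d]; omega)
    simp only [Fin.lt_def] at *
    omega
  simp only [Box.content]
  omega

/-- The coefficient of `v_T` in `aᵢ v_T`, for `i - 1` in the box `b` and `i` in the box `c`. -/
noncomputable def Box.alpha (b c : lam.Box) : K1 := (qq - 1) * c.wt / (c.wt - b.wt)

/-- The coefficient of `v_{s T}` in `aᵢ v_T`. -/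
noncomputable def Box.beta (b c : lam.Box) : K1 :=
  if b.SameRow c ∨ b.SameCol c then 0 else (qq * c.wt - b.wt) / (c.wt - b.wt)

open Classical in
/-- `v_T`, or `0` if the filling is not standard. -/
noncomputable def fvec (e : lam.Box ≃ Fin n) : lam.V :=
  if h : IsStandard e then STab.vec ⟨e, h⟩ else 0

theorem prevSymbol_lt {i : Fin n} (hi : (i : ℕ) ≠ 0) : prevSymbol i < i := by
  simp only [prevSymbol, Fin.lt_def]; omega

theorem genAction_vec (T : lam.STab) (i : Fin n) : lam.genAction i T.vec = T.act i := by
  simp [genAction, STab.vec]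

theorem genAction_zero {e : lam.Box ≃ Fin n} {i : Fin n} (hi : (i : ℕ) = 0) :
    lam.genAction i (fvec e) = uVal (e.symm i).comp • fvec e := by
  by_cases he : IsStandard e
  · simp only [fvec, dif_pos he, genAction_vec, STab.act, if_pos hi, STab.pos]
  · simp [fvec, he]

theorem seminormal_coeffs {b c : lam.Box} (h : b.wt ≠ c.wt) :
    seminormalMatrix (b.content - c.content) (uVal b.comp / uVal c.comp) 0 0 = b.alpha c ∧
    seminormalMatrix (b.content - c.content) (uVal b.comp / uVal c.comp) 1 0 =
      (qq * c.wt - b.wt) / (c.wt - b.wt) := by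
  have hq := qq_ne_zero
  have hc := c.wt_ne_zero
  have hk : qq ^ (b.content - c.content) * (uVal b.comp / uVal c.comp) = b.wt / c.wt := by
    simp only [Box.wt, zpow_sub₀ hq]
    rw [div_mul_div_comm, mul_comm (qq ^ _), mul_comm (qq ^ _)]
  have hd : c.wt - b.wt ≠ 0 := sub_ne_zero.mpr h.symm
  have hd2 : 1 - b.wt / c.wt ≠ 0 := by
    rw [one_sub_div hc]; exact div_ne_zero hd hc
  have hk1 : qq ^ (b.content - c.content - 1) * (uVal b.comp / uVal c.comp) =
      b.wt / c.wt / qq := by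
    rw [zpow_sub_one₀ hq, ← hk]; ring
  constructor
  · simp only [seminormalMatrix, Matrix.smul_apply, hk, Box.alpha, smul_eq_mul]
    simp
    field_simp
  · simp only [seminormalMatrix, Matrix.smul_apply, hk, hk1, smul_eq_mul]
    simp
    field_simp

theorem genAction_fvec {e : lam.Box ≃ Fin n} (he : IsStandard e) {i : Fin n}
    (hi : (i : ℕ) ≠ 0) :
    lam.genAction i (fvec e) =
      (e.symm (prevSymbol i)).alpha (e.symm i) • fvec e +
      (e.symm (prevSymbol i)).beta (e.symm i) • fvec (swapFilling i e) := by
  have hw := he.wt_ne (prevSymbol_lt hi) (by simp only [prevSymbol]; omega)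
  have hsucc : (e (e.symm i) : ℕ) = e (e.symm (prevSymbol i)) + 1 := by
    simp only [Equiv.apply_symm_apply, prevSymbol]; omega
  have hb0 := (e.symm (prevSymbol i)).wt_ne_zero
  have hd : (e.symm i).wt - (e.symm (prevSymbol i)).wt ≠ 0 := sub_ne_zero.mpr hw.symm
  rw [fvec, dif_pos he, genAction_vec, STab.act, if_neg hi]
  by_cases hr : (e.symm (prevSymbol i)).SameRow (e.symm i)
  · have h1 := he.content_of_sameRow hsucc hr
    have h2 : (e.symm i).wt = qq * (e.symm (prevSymbol i)).wt := by
      simp only [Box.wt, h1, ← hr.1, zpow_add_one₀ qq_ne_zero]; ring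
    have h3 : (e.symm (prevSymbol i)).alpha (e.symm i) = qq := by
      rw [Box.alpha, div_eq_iff hd, h2]; ring
    have hr' : (STab.pos ⟨e, he⟩ (prevSymbol i)).SameRow (STab.pos ⟨e, he⟩ i) := hr
    rw [dif_pos hr', h3, Box.beta, if_pos (Or.inl hr),
      zero_smul, add_zero]
  have hr' : ¬ (STab.pos ⟨e, he⟩ (prevSymbol i)).SameRow (STab.pos ⟨e, he⟩ i) := hr
  rw [dif_neg hr']
  by_cases hc : (e.symm (prevSymbol i)).SameCol (e.symm i)
  · have h1 := he.content_of_sameCol hsucc hc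
    have h2 : qq * (e.symm i).wt = (e.symm (prevSymbol i)).wt := by
      simp only [Box.wt, h1, ← hc.1, zpow_sub_one₀ qq_ne_zero]
      field_simp [qq_ne_zero]
    have h3 : (e.symm (prevSymbol i)).alpha (e.symm i) = -1 := by
      rw [Box.alpha, div_eq_iff hd, ← h2]; ring
    have hc' : (STab.pos ⟨e, he⟩ (prevSymbol i)).SameCol (STab.pos ⟨e, he⟩ i) := hc
    rw [dif_pos hc', h3, Box.beta, if_pos (Or.inr hc),
      zero_smul, add_zero, neg_smul, one_smul]
  have hc' : ¬ (STab.pos ⟨e, he⟩ (prevSymbol i)).SameCol (STab.pos ⟨e, he⟩ i) := hc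
  rw [dif_neg hc']
  have hs := seminormal_coeffs hw
  rw [fvec, dif_pos (isStandard_swapFilling he hr hc), Box.beta,
    if_neg (by tauto), ← hs.1, ← hs.2]
  rfl

theorem isStandard_of_beta {e : lam.Box ≃ Fin n} (he : IsStandard e) {i : Fin n}
    (h : (e.symm (prevSymbol i)).beta (e.symm i) ≠ 0) :
    IsStandard (swapFilling i e) := by
  have h2 : ¬ ((e.symm (prevSymbol i)).SameRow (e.symm i) ∨
      (e.symm (prevSymbol i)).SameCol (e.symm i)) := by
    intro h3; exact h (by rw [Box.beta, if_pos h3])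
  exact isStandard_swapFilling he (fun h3 => h2 (Or.inl h3)) (fun h3 => h2 (Or.inr h3))

theorem smul_genAction {e : lam.Box ≃ Fin n} {k : K1} (he : k ≠ 0 → IsStandard e) {i : Fin n}
    (hi : (i : ℕ) ≠ 0) :
    k • lam.genAction i (fvec e) =
      k • ((e.symm (prevSymbol i)).alpha (e.symm i) • fvec e +
      (e.symm (prevSymbol i)).beta (e.symm i) • fvec (swapFilling i e)) := by
  by_cases hk : k = 0
  · simp [hk]
  · rw [genAction_fvec (he hk) hi]

theorem swapFilling_symm (e : lam.Box ≃ Fin n) (i k : Fin n) :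
    (swapFilling i e).symm k = e.symm (Equiv.swap (prevSymbol i) i k) := by
  simp [swapFilling]

theorem swapFilling_swapFilling (e : lam.Box ≃ Fin n) (i : Fin n) :
    swapFilling i (swapFilling i e) = e := by
  ext b; simp [swapFilling]

theorem Box.alpha_add_alpha {b c : lam.Box} (h : b.wt ≠ c.wt) :
    b.alpha c + c.alpha b = qq - 1 := by
  have h1 : c.wt - b.wt ≠ 0 := sub_ne_zero.mpr h.symm
  have h2 : b.wt - c.wt ≠ 0 := sub_ne_zero.mpr h
  simp only [Box.alpha]
  field_simp
  ring

theorem Box.alpha_three {b c d : lam.Box} (h12 : b.wt ≠ c.wt) (h23 : c.wt ≠ d.wt)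
    (h13 : b.wt ≠ d.wt) :
    b.alpha c * c.alpha d + b.alpha d * c.alpha b = c.alpha d * b.alpha d := by
  have h1 : c.wt - b.wt ≠ 0 := sub_ne_zero.mpr h12.symm
  have h2 : b.wt - c.wt ≠ 0 := sub_ne_zero.mpr h12
  have h3 : d.wt - c.wt ≠ 0 := sub_ne_zero.mpr h23.symm
  have h4 : d.wt - b.wt ≠ 0 := sub_ne_zero.mpr h13.symm
  simp only [Box.alpha]
  field_simp
  ring

theorem Box.alpha_three' {b c d : lam.Box} (h12 : b.wt ≠ c.wt) (h23 : c.wt ≠ d.wt)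
    (h13 : b.wt ≠ d.wt) :
    c.alpha d * b.alpha c + b.alpha d * d.alpha c = b.alpha c * b.alpha d := by
  have h1 : c.wt - b.wt ≠ 0 := sub_ne_zero.mpr h12.symm
  have h2 : c.wt - d.wt ≠ 0 := sub_ne_zero.mpr h23
  have h3 : d.wt - c.wt ≠ 0 := sub_ne_zero.mpr h23.symm
  have h4 : d.wt - b.wt ≠ 0 := sub_ne_zero.mpr h13.symm
  simp only [Box.alpha]
  field_simp
  ring

theorem Box.alpha_diag {b c d : lam.Box} (h12 : b.wt ≠ c.wt) (h23 : c.wt ≠ d.wt)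
    (h13 : b.wt ≠ d.wt) :
    b.alpha c * b.alpha c * c.alpha d +
        ((qq - 1) * b.alpha c + qq - b.alpha c * b.alpha c) * b.alpha d =
      c.alpha d * c.alpha d * b.alpha c +
        ((qq - 1) * c.alpha d + qq - c.alpha d * c.alpha d) * b.alpha d := by
  have h1 : c.wt - b.wt ≠ 0 := sub_ne_zero.mpr h12.symm
  have h3 : d.wt - c.wt ≠ 0 := sub_ne_zero.mpr h23.symm
  have h4 : d.wt - b.wt ≠ 0 := sub_ne_zero.mpr h13.symm
  simp only [Box.alpha]
  field_simp
  ring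

theorem IsStandard.alpha_cases {e : lam.Box ≃ Fin n} (he : IsStandard e) {b c : lam.Box}
    (h : (e c : ℕ) = e b + 1) (hbc : b.wt ≠ c.wt) (hadj : b.SameRow c ∨ b.SameCol c) :
    b.alpha c = qq ∨ b.alpha c = -1 := by
  have hd : c.wt - b.wt ≠ 0 := sub_ne_zero.mpr hbc.symm
  rcases hadj with hr | hc
  · left
    have h1 := he.content_of_sameRow h hr
    have h2 : c.wt = qq * b.wt := by
      simp only [Box.wt, h1, ← hr.1, zpow_add_one₀ qq_ne_zero]; ring
    rw [Box.alpha, div_eq_iff hd, h2]; ring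
  · right
    have h1 := he.content_of_sameCol h hc
    have h2 : qq * c.wt = b.wt := by
      simp only [Box.wt, h1, ← hc.1, zpow_sub_one₀ qq_ne_zero]
      field_simp [qq_ne_zero]
    rw [Box.alpha, div_eq_iff hd, ← h2]; ring

theorem IsStandard.beta_mul_beta {e : lam.Box ≃ Fin n} (he : IsStandard e) {b c : lam.Box}
    (h : (e c : ℕ) = e b + 1) (hbc : b.wt ≠ c.wt) :
    b.beta c * c.beta b = (qq - 1) * b.alpha c + qq - b.alpha c * b.alpha c := by
  by_cases hadj : b.SameRow c ∨ b.SameCol c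
  · rw [Box.beta, if_pos hadj]
    rcases he.alpha_cases h hbc hadj with h1 | h1 <;> rw [h1] <;> ring
  · have hadj' : ¬ (c.SameRow b ∨ c.SameCol b) := by
      rintro (h1 | h1)
      · exact hadj (Or.inl ⟨h1.1.symm, h1.2.symm⟩)
      · exact hadj (Or.inr ⟨h1.1.symm, h1.2.symm⟩)
    rw [Box.beta, if_neg hadj, Box.beta, if_neg hadj', Box.alpha]
    have h1 : c.wt - b.wt ≠ 0 := sub_ne_zero.mpr hbc.symm
    have h2 : b.wt - c.wt ≠ 0 := sub_ne_zero.mpr hbc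
    field_simp
    ring

theorem end_ext {f g : Module.End K1 lam.V}
    (h : ∀ e : lam.Box ≃ Fin n, IsStandard e → f (fvec e) = g (fvec e)) : f = g := by
  apply Finsupp.lhom_ext'
  intro T
  ext1
  have := h T.1 T.2
  simpa [fvec, T.2, STab.vec] using this

theorem genAction_quad_zero (i : Fin n) (hi : (i : ℕ) = 0) :
    lam.genAction i * lam.genAction i = ((1 : K1) - 1) • lam.genAction i + (1 : K1) • 1 := by
  apply end_ext
  intro e he
  simp only [Module.End.mul_apply, LinearMap.add_apply, LinearMap.smul_apply,
    Module.End.one_apply, genAction_zero hi, map_smul, smul_smul]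
  rcases uVal_cases (e.symm i).comp with h | h <;> simp [h]

theorem genAction_quad (i : Fin n) (hi : (i : ℕ) ≠ 0) :
    lam.genAction i * lam.genAction i = (qq - 1) • lam.genAction i + qq • 1 := by
  apply end_ext
  intro e he
  have hw := he.wt_ne (prevSymbol_lt hi) (by simp only [prevSymbol]; omega)
  have hsucc : (e (e.symm i) : ℕ) = e (e.symm (prevSymbol i)) + 1 := by
    simp only [Equiv.apply_symm_apply, prevSymbol]; omega
  have A := genAction_fvec he hi
  have B := smul_genAction (e := swapFilling i e) (isStandard_of_beta he) hi
  simp only [swapFilling_swapFilling, swapFilling_symm, Equiv.swap_apply_left,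
    Equiv.swap_apply_right] at B
  have h1 := Box.alpha_add_alpha hw
  have h2 := he.beta_mul_beta hsucc hw
  simp only [Module.End.mul_apply, LinearMap.add_apply, LinearMap.smul_apply,
    Module.End.one_apply]
  generalize (e.symm (prevSymbol i)) = b at *
  generalize (e.symm i) = c at *
  generalize fvec (swapFilling i e) = v' at *
  generalize fvec e = v at *
  rw [A, map_add, map_smul, map_smul, B, A]
  linear_combination (norm := module) h2 • v + (b.beta c * h1) • v'

theorem genAction_comm (i j : Fin n) (hij : (i : ℕ) + 1 < j) :
    lam.genAction i * lam.genAction j = lam.genAction j * lam.genAction i := by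
  apply end_ext
  intro e he
  have hj : (j : ℕ) ≠ 0 := by omega
  have n1 : i ≠ j := by simp only [ne_eq, Fin.ext_iff]; omega
  have n2 : i ≠ prevSymbol j := by simp only [prevSymbol, ne_eq, Fin.ext_iff]; omega
  have n3 : prevSymbol i ≠ j := by simp only [prevSymbol, ne_eq, Fin.ext_iff]; omega
  have n4 : prevSymbol i ≠ prevSymbol j := by
    simp only [prevSymbol, ne_eq, Fin.ext_iff]; omega
  have Aj := genAction_fvec he hj
  simp only [Module.End.mul_apply]
  by_cases hi : (i : ℕ) = 0
  · have h1 := genAction_zero (lam := lam) (e := swapFilling j e) hi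
    rw [swapFilling_symm, Equiv.swap_apply_of_ne_of_ne n2 n1] at h1
    rw [genAction_zero hi, map_smul, Aj, map_add, map_smul, map_smul, h1, genAction_zero hi]
    module
  · have Ai := genAction_fvec he hi
    have Bi := smul_genAction (e := swapFilling j e) (isStandard_of_beta he) hi
    have Bj := smul_genAction (e := swapFilling i e) (isStandard_of_beta he) hj
    have hcomm : swapFilling j (swapFilling i e) = swapFilling i (swapFilling j e) := by
      ext b
      simp only [swapFilling, Equiv.trans_apply]
      have : ∀ x, Equiv.swap (prevSymbol j) j (Equiv.swap (prevSymbol i) i x) =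
          Equiv.swap (prevSymbol i) i (Equiv.swap (prevSymbol j) j x) := by
        intro x
        simp only [Equiv.swap_apply_def]
        split_ifs <;> simp_all
      rw [this]
    rw [swapFilling_symm, swapFilling_symm, Equiv.swap_apply_of_ne_of_ne n2 n1,
      Equiv.swap_apply_of_ne_of_ne n4 n3] at Bi
    rw [swapFilling_symm, swapFilling_symm, Equiv.swap_apply_of_ne_of_ne n3.symm n1.symm,
      Equiv.swap_apply_of_ne_of_ne n4.symm n2.symm, hcomm] at Bj
    rw [Aj, Ai]
    simp only [map_add, map_smul]
    rw [Bi, Bj, Ai, Aj]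
    module

theorem IsStandard.content_eq_zero {e : lam.Box ≃ Fin n} (he : IsStandard e) {b c : lam.Box}
    (hb : (e b : ℕ) = 0) (hc : (e c : ℕ) = 1) (hne : b.comp ≠ c.comp) :
    b.content = 0 ∧ c.content = 0 := by
  have key : ∀ d : lam.Box, (∀ d' : lam.Box, e d' < e d → d'.comp ≠ d.comp) →
      d.content = 0 := by
    intro d hd
    let d0 : lam.Box :=
      ⟨d.comp, 0, 0, (lam.shape d.comp).up_left_mem (Nat.zero_le _) (Nat.zero_le _) d.mem⟩
    have h0 : d0 = d := by
      by_contra h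
      exact hd d0 (he.lt rfl (Nat.zero_le _) (Nat.zero_le _) h) rfl
    rw [← h0]
    simp [d0, Box.content]
  refine ⟨key b fun d' h => ?_, key c fun d' h => ?_⟩
  · rw [Fin.lt_def] at h; omega
  · have : d' = b := e.injective (by rw [Fin.lt_def] at h; rw [Fin.ext_iff]; omega)
    rwa [this]

theorem genAction_braid_four (i j : Fin n) (hi : (i : ℕ) = 0) (hj : (j : ℕ) = 1) :
    lam.genAction i * lam.genAction j * lam.genAction i * lam.genAction j =
      lam.genAction j * lam.genAction i * lam.genAction j * lam.genAction i := by
  apply end_ext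
  intro e he
  have hj0 : (j : ℕ) ≠ 0 := by omega
  have hp : prevSymbol j = i := by simp only [prevSymbol, Fin.ext_iff]; omega
  have A := genAction_fvec he hj0
  have B := smul_genAction (e := swapFilling j e) (isStandard_of_beta he) hj0
  have C := genAction_zero (lam := lam) (e := e) hi
  have D := genAction_zero (lam := lam) (e := swapFilling j e) hi
  have hw := he.wt_ne (prevSymbol_lt hj0) (by simp only [prevSymbol]; omega)
  simp only [swapFilling_swapFilling, swapFilling_symm, hp, Equiv.swap_apply_left,
    Equiv.swap_apply_right] at A B D hw
  have key : (e.symm i).comp = (e.symm j).comp ∨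
      (uVal (e.symm j).comp = -uVal (e.symm i).comp ∧
        (e.symm i).alpha (e.symm j) = (e.symm j).alpha (e.symm i)) := by
    by_cases hcomp : (e.symm i).comp = (e.symm j).comp
    · exact Or.inl hcomp
    · have h1 : uVal (e.symm j).comp = -uVal (e.symm i).comp :=
        (uVal_eq_or _ _).resolve_left hcomp
      obtain ⟨h2, h3⟩ := he.content_eq_zero (b := e.symm i) (c := e.symm j)
        (by simpa using hi) (by simpa using hj) hcomp
      have h4 : (e.symm j).wt = -(e.symm i).wt := by simp [Box.wt, h1, h2, h3]
      have h5 : (e.symm j).wt - (e.symm i).wt ≠ 0 := sub_ne_zero.mpr hw.symm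
      have h6 : (e.symm i).wt - (e.symm j).wt ≠ 0 := sub_ne_zero.mpr hw
      refine Or.inr ⟨h1, ?_⟩
      rw [Box.alpha, Box.alpha, div_eq_div_iff h5 h6, h4]
      ring
  simp only [Module.End.mul_apply]
  generalize (e.symm i) = b at *
  generalize (e.symm j) = c at *
  generalize fvec (swapFilling j e) = v' at *
  generalize fvec e = v at *
  have E : ∀ x y : K1, lam.genAction j (x • v + (y * b.beta c) • v') =
      (x * b.alpha c + y * b.beta c * c.beta b) • v +
        ((x + y * c.alpha b) * b.beta c) • v' := by
    intro x y
    rw [map_add, map_smul, A, mul_smul, map_smul, map_smul, B]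
    module
  have F : ∀ x y : K1, lam.genAction i (x • v + (y * b.beta c) • v') =
      (x * uVal b.comp) • v + (y * uVal c.comp * b.beta c) • v' := by
    intro x y
    rw [map_add, map_smul, map_smul, C, D]
    module
  have G : v = (1 : K1) • v + ((0 : K1) * b.beta c) • v' := by module
  rw [G, E, F, E, F, F, E, F, E]
  have hb := uVal_cases b.comp
  congr 2
  · rcases key with h | ⟨h, h'⟩
    · rw [h]; ring
    · rw [h, h']; ring
  · rcases key with h | ⟨h, h'⟩
    · rw [h]; ring
    · rw [h, h']; ring

theorem genAction_braid_three (i j : Fin n) (hi : (i : ℕ) ≠ 0) (hj : (j : ℕ) = i + 1) :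
    lam.genAction i * lam.genAction j * lam.genAction i =
      lam.genAction j * lam.genAction i * lam.genAction j := by
  apply end_ext
  intro e he
  have hj0 : (j : ℕ) ≠ 0 := by omega
  have hp : prevSymbol j = i := by simp only [prevSymbol, Fin.ext_iff]; omega
  have n1 : prevSymbol i ≠ i := (prevSymbol_lt hi).ne
  have n2 : i ≠ j := by simp only [ne_eq, Fin.ext_iff]; omega
  have n3 : prevSymbol i ≠ j := by simp only [prevSymbol, ne_eq, Fin.ext_iff]; omega
  have w12 := he.wt_ne (prevSymbol_lt hi) (by simp only [prevSymbol]; omega)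
  have w23 := he.wt_ne (k := i) (l := j) (by rw [Fin.lt_def]; omega) (by omega)
  have w13 := he.wt_ne (k := prevSymbol i) (l := j)
    (by simp only [prevSymbol, Fin.lt_def]; omega) (by simp only [prevSymbol]; omega)
  have s12 : (e (e.symm i) : ℕ) = e (e.symm (prevSymbol i)) + 1 := by
    simp only [Equiv.apply_symm_apply, prevSymbol]; omega
  have s23 : (e (e.symm j) : ℕ) = e (e.symm i) + 1 := by
    simp only [Equiv.apply_symm_apply]; omega
  have g12 := he.beta_mul_beta s12 w12
  have g23 := he.beta_mul_beta s23 w23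
  have hi1 : ∀ f : lam.Box ≃ Fin n, (swapFilling i f).symm (prevSymbol i) = f.symm i := by
    intro f; rw [swapFilling_symm, Equiv.swap_apply_left]
  have hi2 : ∀ f : lam.Box ≃ Fin n, (swapFilling i f).symm i = f.symm (prevSymbol i) := by
    intro f; rw [swapFilling_symm, Equiv.swap_apply_right]
  have hi3 : ∀ f : lam.Box ≃ Fin n, (swapFilling i f).symm j = f.symm j := by
    intro f; rw [swapFilling_symm, Equiv.swap_apply_of_ne_of_ne n3.symm n2.symm]
  have hj1 : ∀ f : lam.Box ≃ Fin n,
      (swapFilling j f).symm (prevSymbol i) = f.symm (prevSymbol i) := by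
    intro f; rw [swapFilling_symm, hp, Equiv.swap_apply_of_ne_of_ne n1 n3]
  have hj2 : ∀ f : lam.Box ≃ Fin n, (swapFilling j f).symm i = f.symm j := by
    intro f; rw [swapFilling_symm, hp, Equiv.swap_apply_left]
  have hj3 : ∀ f : lam.Box ≃ Fin n, (swapFilling j f).symm j = f.symm i := by
    intro f; rw [swapFilling_symm, hp, Equiv.swap_apply_right]
  have hbr : swapFilling j (swapFilling i (swapFilling j e)) =
      swapFilling i (swapFilling j (swapFilling i e)) := by
    apply Equiv.symm_bijective.injective
    ext1 k
    by_cases h1 : k = prevSymbol i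
    · subst h1; simp only [hi1, hi3, hj1, hj2]
    by_cases h2 : k = i
    · subst h2; simp only [hi1, hi2, hi3, hj1, hj2, hj3]
    by_cases h3 : k = j
    · subst h3; simp only [hi2, hi3, hj1, hj3]
    · simp only [swapFilling_symm, hp, Equiv.swap_apply_of_ne_of_ne h1 h2,
        Equiv.swap_apply_of_ne_of_ne h2 h3]
  have t1 := isStandard_of_beta he (i := i)
  have t2 := isStandard_of_beta he (i := j)
  rw [hp] at t2
  have t12 : (e.symm (prevSymbol i)).beta (e.symm i) * (e.symm (prevSymbol i)).beta (e.symm j) ≠ 0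
      → IsStandard (swapFilling j (swapFilling i e)) := by
    intro h
    have := isStandard_of_beta (t1 (left_ne_zero_of_mul h)) (i := j)
    rw [hp, hi2, hi3] at this
    exact this (right_ne_zero_of_mul h)
  have t21 : (e.symm i).beta (e.symm j) * (e.symm (prevSymbol i)).beta (e.symm j) ≠ 0
      → IsStandard (swapFilling i (swapFilling j e)) := by
    intro h
    have := isStandard_of_beta (t2 (left_ne_zero_of_mul h)) (i := i)
    rw [hj1, hj2] at this
    exact this (right_ne_zero_of_mul h)
  have A := genAction_fvec he hi
  have B := genAction_fvec he hj0
  have C1 := smul_genAction t1 hj0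
  have C1' := smul_genAction t1 hi
  have C2 := smul_genAction t2 hi
  have C2' := smul_genAction t2 hj0
  have D12 := smul_genAction t12 hi
  have D21 := smul_genAction t21 hj0
  simp only [hp, hi1, hi2, hi3, hj1, hj2, hj3, swapFilling_swapFilling, hbr] at *
  have r1 := Box.alpha_three w12 w23 w13
  have r2 := Box.alpha_three' w12 w23 w13
  have r3 := Box.alpha_diag w12 w23 w13
  clear t1 t2 t12 t21 hi1 hi2 hi3 hj1 hj2 hj3 hbr s12 s23 w12 w23 w13
  simp only [Module.End.mul_apply]
  generalize e.symm (prevSymbol i) = b at *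
  generalize e.symm i = c at *
  generalize e.symm j = d at *
  generalize fvec (swapFilling i (swapFilling j (swapFilling i e))) = v121 at *
  generalize fvec (swapFilling j (swapFilling i e)) = v12 at *
  generalize fvec (swapFilling i (swapFilling j e)) = v21 at *
  generalize fvec (swapFilling i e) = v1 at *
  generalize fvec (swapFilling j e) = v2 at *
  generalize fvec e = v at *
  have E1 : lam.genAction i (lam.genAction j (lam.genAction i v)) =
      (b.alpha c * c.alpha d) • (b.alpha c • v + b.beta c • v1) +
      b.alpha c • (c.beta d • (b.alpha d • v2 + b.beta d • v21)) +
      b.alpha d • (b.beta c • (c.alpha b • v1 + c.beta b • v)) +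
      (b.beta c * b.beta d) • (c.alpha d • v12 + c.beta d • v121) := by
    rw [← C2, ← C1', ← D12, ← A, A, map_add, map_smul, map_smul, B, C1]
    simp only [map_add, map_smul]
    rw [A]
    module
  have E2 : lam.genAction j (lam.genAction i (lam.genAction j v)) =
      (c.alpha d * b.alpha c) • (c.alpha d • v + c.beta d • v2) +
      c.alpha d • (b.beta c • (b.alpha d • v1 + b.beta d • v12)) +
      b.alpha d • (c.beta d • (d.alpha c • v2 + d.beta c • v)) +
      (c.beta d * b.beta d) • (b.alpha c • v21 + b.beta c • v121) := by
    rw [← C1, ← C2', ← D21, ← B, B, map_add, map_smul, map_smul, A, C2]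
    simp only [map_add, map_smul]
    rw [B]
    module
  rw [E1, E2]
  linear_combination (norm := module) (r3 + b.alpha d * g12 - b.alpha d * g23) • v +
    (b.beta c * r1) • v1 - (c.beta d * r2) • v2

theorem isHeckeBFamily_genAction (lam : BiPartition n) :
    IsHeckeBFamily (1 : K1) qq lam.genAction where
  quad_zero := genAction_quad_zero
  quad := genAction_quad
  braid_four := genAction_braid_four
  braid_three := genAction_braid_three
  comm := genAction_comm

end BiPartition

/-! ### The representations and their restrictions -/

/-- The seminormal form representation `π_λ` of `ℋ_{K₁,Bₙ}(1,q)` on `V_λ`. -/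
noncomputable def BiPartition.rep {n : ℕ} (lam : BiPartition n) :
    HeckeB n (1 : K1) qq →ₐ[K1] Module.End K1 lam.V :=
  HeckeB.lift lam.isHeckeBFamily_genAction

/-- The restriction `π_{λ,†}` of `π_λ` to `ℋ†`. -/
noncomputable def BiPartition.repDagger {n : ℕ} (lam : BiPartition n) :
    HeckeB.dagger n qq →ₐ[K1] Module.End K1 lam.V :=
  lam.rep.comp (HeckeB.dagger n qq).val

/-- Equivalence of representations: a linear isomorphism that intertwines the two actions. -/
def RepEquivalent {K A V W : Type*} [Field K] [Semiring A] [Algebra K A] [AddCommGroup V]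
    [Module K V] [AddCommGroup W] [Module K W] (ρ : A →ₐ[K] Module.End K V) (σ : A →ₐ[K] Module.End K W) :
    Prop :=
  ∃ e : V ≃ₗ[K] W, ∀ (a : A) (v : V), e (ρ a v) = σ a (e v)

/-! ### Equivalence of representations -/

/-! An algebra endomorphism `φ` of the Hecke algebra that fixes `ℋ†` pointwise does not change the
restriction to `ℋ†` of a representation composed with it. It is therefore enough to find, for `♯`
and for `♭`, a linear isomorphism intertwining the twist of `π_λ` with `π_{λ*}` and with `π_{λ'}`
respectively, and this need only be tested on the generators (`repDagger_equivalent_of_twist`).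

The seminormal matrices depend on a tableau only through the weights `wt = u_ρ q^content` of the
boxes `b`, `c` holding `i - 1`, `i`: `aᵢ v_T = α(b,c) v_T + β(b,c) v_{sT}`, with `α(b,c) =
(q-1)c/(c-b)` and, for `b`, `c` neither in a common row nor in a common column, `β(b,c) =
(qc-b)/(c-b)`, where a box stands for its weight.

Exchanging the two diagrams negates all weights. Since `α` and `β` are homogeneous of degree zero,
only the sign of `a₁` changes, and `v_T ↦ v_{T*}` intertwines the twist by `♯` with `π_{λ*}`.

Transposing inverts all weights, which turns `α(b,c)` into `α(c,b) = q - 1 - α(b,c)`. This is the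
diagonal coefficient of `(q-1) - aᵢ`. Off the diagonal, `-β(b,c)` has to become `β(c,b)`, so `v_T`
must be sent to `scale T • v_{T'}` with `scale(sT)/scale(T) = (qb-c)/(qc-b)`. The product of
`q·wt(later) - wt(earlier)` over all pairs of symbols has this property, because `s` reverses the
order of the pair `(i-1, i)` alone. Vanishing factors are replaced by `1`, which is harmless: the
factors of this pair do not vanish where `β` is nonzero (`IsStandard.qq_mul_wt_ne`).

The remaining equivalences follow by symmetry and transitivity; twists by `♯` and `♭` suffice. -/

theorem RepEquivalent.symm {K A V W : Type*} [Field K] [Semiring A] [Algebra K A]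
    [AddCommGroup V] [Module K V] [AddCommGroup W] [Module K W] {ρ : A →ₐ[K] Module.End K V}
    {σ : A →ₐ[K] Module.End K W} (h : RepEquivalent ρ σ) : RepEquivalent σ ρ := by
  obtain ⟨e, he⟩ := h
  exact ⟨e.symm, fun a v => by rw [LinearEquiv.symm_apply_eq, he, LinearEquiv.apply_symm_apply]⟩

theorem RepEquivalent.trans {K A U V W : Type*} [Field K] [Semiring A] [Algebra K A]
    [AddCommGroup U] [Module K U] [AddCommGroup V] [Module K V] [AddCommGroup W] [Module K W]
    {ρ : A →ₐ[K] Module.End K U} {σ : A →ₐ[K] Module.End K V} {τ : A →ₐ[K] Module.End K W}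
    (h : RepEquivalent ρ σ) (h' : RepEquivalent σ τ) : RepEquivalent ρ τ := by
  obtain ⟨e, he⟩ := h
  obtain ⟨f, hf⟩ := h'
  exact ⟨e.trans f, fun a v => by simp only [LinearEquiv.trans_apply, he, hf]⟩

namespace BiPartition

variable {n : ℕ} {lam mu : BiPartition n}

/-! ### Twists by endomorphisms fixing `ℋ†` -/

theorem rep_gen (lam : BiPartition n) (i : Fin n) :
    lam.rep (HeckeB.gen 1 qq i) = lam.genAction i :=
  HeckeB.lift_gen _ i

/-- If `E` intertwines the twist of `π_λ` by `φ` with `π_μ`, and `φ` fixes `ℋ†`, then the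
restrictions of `π_λ` and `π_μ` to `ℋ†` are equivalent. -/
theorem repDagger_equivalent_of_twist (φ : HeckeB n (1 : K1) qq →ₐ[K1] HeckeB n (1 : K1) qq)
    (hφ : ∀ a ∈ HeckeB.dagger n qq, φ a = a) (E : lam.V ≃ₗ[K1] mu.V)
    (hE : ∀ i v, E (lam.rep (φ (HeckeB.gen 1 qq i)) v) = mu.genAction i (E v)) :
    RepEquivalent lam.repDagger mu.repDagger := by
  -- Both sides are algebra homomorphisms on the Hecke algebra, so the intertwining relation passes
  -- from the generators to all elements.
  have key : (E.conjAlgEquiv K1).toAlgHom.comp (lam.rep.comp φ) = mu.rep := by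
    refine HeckeB.hom_ext (A := Module.End K1 mu.V) fun i => LinearMap.ext fun v => ?_
    obtain ⟨v, rfl⟩ := E.surjective v
    rw [rep_gen, ← hE]
    simp [LinearEquiv.conjAlgEquiv]
  refine ⟨E, fun a v => ?_⟩
  have h := LinearMap.congr_fun (DFunLike.congr_fun key (a : HeckeB n (1 : K1) qq)) (E v)
  simp only [repDagger, AlgHom.comp_apply, Subalgebra.coe_val]
  rw [← h]
  simp [LinearEquiv.conjAlgEquiv, hφ a a.2]

/-! ### Monomial maps induced by bijections of boxes -/

/-- The bijection of standard tableaux induced by a bijection of boxes. -/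
def tabEquiv (φ : lam.Box ≃ mu.Box)
    (hφ : ∀ e : lam.Box ≃ Fin n, IsStandard e ↔ IsStandard (φ.symm.trans e)) :
    lam.STab ≃ mu.STab :=
  (φ.equivCongr (Equiv.refl (Fin n))).subtypeEquiv hφ

/-- The linear equivalence `v_T ↦ w_T v_{φ T}`. -/
noncomputable def scaledEquiv (φ : lam.Box ≃ mu.Box)
    (hφ : ∀ e : lam.Box ≃ Fin n, IsStandard e ↔ IsStandard (φ.symm.trans e))
    (w : (lam.Box ≃ Fin n) → K1) (hw : ∀ e, w e ≠ 0) : lam.V ≃ₗ[K1] mu.V :=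
  (Finsupp.basisSingleOne (R := K1) (ι := lam.STab)).equiv
    ((Finsupp.basisSingleOne (R := K1) (ι := mu.STab)).isUnitSMul
      -- The target basis is the one rescaled, so the factor of a tableau of shape `mu` is read off
      -- from its preimage.
      (w := fun T => w ((tabEquiv φ hφ).symm T).1) fun _ => (hw _).isUnit)
    (tabEquiv φ hφ)

/-- For a nonstandard filling both sides are zero. Hence the formula also applies to `swapFilling i
e`, with no case distinction on whether it is standard. -/
theorem scaledEquiv_fvec (φ : lam.Box ≃ mu.Box)
    (hφ : ∀ e : lam.Box ≃ Fin n, IsStandard e ↔ IsStandard (φ.symm.trans e))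
    (w : (lam.Box ≃ Fin n) → K1) (hw : ∀ e, w e ≠ 0) (e : lam.Box ≃ Fin n) :
    scaledEquiv φ hφ w hw (fvec e) = w e • fvec (φ.symm.trans e) := by
  by_cases he : IsStandard e
  · have h := Module.Basis.equiv_apply (Finsupp.basisSingleOne (R := K1) (ι := lam.STab)) ⟨e, he⟩
      ((Finsupp.basisSingleOne (R := K1) (ι := mu.STab)).isUnitSMul
        (w := fun T => w ((tabEquiv φ hφ).symm T).1) fun _ => (hw _).isUnit)
      (tabEquiv φ hφ)
    rw [Module.Basis.isUnitSMul_apply, Finsupp.coe_basisSingleOne, Finsupp.coe_basisSingleOne,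
      Equiv.symm_apply_apply] at h
    rw [fvec, dif_pos he, fvec, dif_pos ((hφ e).1 he)]
    exact h
  · rw [fvec, dif_neg he, fvec, dif_neg fun h => he ((hφ e).2 h), map_zero, smul_zero]

/-- The exchange acts on symbols and `φ` on boxes, so the two operations commute. -/
theorem swapFilling_trans (φ : lam.Box ≃ mu.Box) (e : lam.Box ≃ Fin n) (i : Fin n) :
    swapFilling i (φ.symm.trans e) = φ.symm.trans (swapFilling i e) := rfl

theorem symm_trans_symm (φ : lam.Box ≃ mu.Box) (e : lam.Box ≃ Fin n) (k : Fin n) :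
    (φ.symm.trans e).symm k = φ (e.symm k) := rfl

theorem linearMap_ext_fvec {W : Type*} [AddCommGroup W] [Module K1 W] {f g : lam.V →ₗ[K1] W}
    (h : ∀ e : lam.Box ≃ Fin n, IsStandard e → f (fvec e) = g (fvec e)) : f = g := by
  apply Finsupp.lhom_ext'
  intro T
  ext1
  have := h T.1 T.2
  simpa [fvec, T.2, STab.vec] using this

/-! ### Exchanging the two diagrams -/

theorem star_shape (lam : BiPartition n) (α : Fin 2) : lam.star.shape (1 - α) = lam.shape α := by
  fin_cases α <;> rfl

theorem shape_one_sub (lam : BiPartition n) (α : Fin 2) :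
    lam.shape (1 - α) = lam.star.shape α := by
  fin_cases α <;> rfl

/-- The boxes of `λ*` are those of `λ` with the component changed. -/
def starBox (lam : BiPartition n) : lam.Box ≃ lam.star.Box where
  toFun b := ⟨1 - b.comp, b.row, b.col, by rw [star_shape]; exact b.mem⟩
  invFun b := ⟨1 - b.comp, b.row, b.col, by rw [shape_one_sub]; exact b.mem⟩
  left_inv b := by ext <;> simp
  right_inv b := by ext <;> simp

theorem isStandard_star (e : lam.Box ≃ Fin n) :
    IsStandard e ↔ IsStandard (lam.starBox.symm.trans e) := by
  constructor
  · intro h b c hbc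
    exact h (lam.starBox.symm b) (lam.starBox.symm c) (congrArg (1 - ·) hbc)
  · intro h b c hbc
    have := h (lam.starBox b) (lam.starBox c) (congrArg (1 - ·) hbc)
    simp only [Equiv.trans_apply, Equiv.symm_apply_apply] at this
    exact this

theorem uVal_one_sub (α : Fin 2) : uVal (1 - α) = -uVal α := by
  fin_cases α <;> simp [uVal]

/-- The content is unchanged and the sign `u_ρ` flips, since `u₁ = 1` and `u₂ = -1`. -/
theorem wt_starBox (b : lam.Box) : (lam.starBox b).wt = -b.wt := by
  change uVal (1 - b.comp) * qq ^ b.content = _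
  rw [uVal_one_sub, Box.wt, neg_mul]

/-- Numerator and denominator are linear in the weights, so the common sign cancels. -/
theorem alpha_starBox (b c : lam.Box) : (lam.starBox b).alpha (lam.starBox c) = b.alpha c := by
  rw [Box.alpha, Box.alpha, wt_starBox, wt_starBox, mul_neg, neg_sub_neg, ← neg_sub c.wt b.wt,
    neg_div_neg_eq]

theorem beta_starBox (b c : lam.Box) : (lam.starBox b).beta (lam.starBox c) = b.beta c := by
  have h1 : (lam.starBox b).SameRow (lam.starBox c) ↔ b.SameRow c := by
    simp [starBox]
  have h2 : (lam.starBox b).SameCol (lam.starBox c) ↔ b.SameCol c := by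
    simp [starBox]
  rw [Box.beta, Box.beta, wt_starBox, wt_starBox, mul_neg, neg_sub_neg, neg_sub_neg,
    ← neg_sub c.wt b.wt, ← neg_sub (qq * c.wt) b.wt, neg_div_neg_eq]
  simp only [h1, h2]

/-- The twist is by `♯`. No rescaling is needed, as the coefficients of `aᵢ` for `i ≥ 2` are
literally the same for `λ` and `λ*`. -/
theorem repDagger_equivalent_star (lam : BiPartition n) :
    RepEquivalent lam.repDagger lam.star.repDagger := by
  have hw : ∀ e : lam.Box ≃ Fin n, (fun _ => (1 : K1)) e ≠ 0 := fun _ => one_ne_zero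
  refine repDagger_equivalent_of_twist (HeckeB.sharp n qq) (fun a ha => ha.1.1)
    (scaledEquiv lam.starBox isStandard_star (fun _ => 1) hw) fun i v => ?_
  rw [HeckeB.sharp, HeckeB.lift_gen]
  suffices h : (scaledEquiv lam.starBox isStandard_star (fun _ => 1) hw).toLinearMap ∘ₗ
      lam.rep (if (i : ℕ) = 0 then -HeckeB.gen 1 qq i else HeckeB.gen 1 qq i) =
      lam.star.genAction i ∘ₗ
        (scaledEquiv lam.starBox isStandard_star (fun _ => 1) hw).toLinearMap from
    LinearMap.congr_fun h v
  apply linearMap_ext_fvec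
  intro e he
  simp only [LinearMap.comp_apply, LinearEquiv.coe_coe, scaledEquiv_fvec, one_smul]
  by_cases hi : (i : ℕ) = 0
  · rw [if_pos hi, map_neg, rep_gen, LinearMap.neg_apply, map_neg, genAction_zero hi, map_smul,
      scaledEquiv_fvec, one_smul, genAction_zero hi, symm_trans_symm]
    -- The sign introduced by `♯` is absorbed by the change of component of the box holding the
    -- first symbol.
    change _ = uVal (1 - _) • _
    rw [uVal_one_sub, neg_smul]
  · rw [if_neg hi, rep_gen, genAction_fvec he hi, genAction_fvec ((isStandard_star e).1 he) hi,
      map_add, map_smul, map_smul, scaledEquiv_fvec, scaledEquiv_fvec, one_smul, one_smul,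
      symm_trans_symm, symm_trans_symm, alpha_starBox, beta_starBox, swapFilling_trans]

/-! ### Transposing the two diagrams -/

/-- The boxes of `λ'` are those of `λ` with rows and columns exchanged. -/
def transposeBox (lam : BiPartition n) : lam.Box ≃ lam.transpose.Box where
  toFun b := ⟨b.comp, b.col, b.row, YoungDiagram.mem_transpose.2 b.mem⟩
  invFun b := ⟨b.comp, b.col, b.row, YoungDiagram.mem_transpose.1 b.mem⟩
  left_inv _ := rfl
  right_inv _ := rfl

theorem isStandard_transpose (e : lam.Box ≃ Fin n) :
    IsStandard e ↔ IsStandard (lam.transposeBox.symm.trans e) :=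
  ⟨fun h b c hbc => (h (lam.transposeBox.symm b) (lam.transposeBox.symm c) hbc).symm,
    fun h b c hbc => (h (lam.transposeBox b) (lam.transposeBox c) hbc).symm⟩

/-- Transposition negates the content and keeps the component, and `u_ρ = ±1` is its own inverse. -/
theorem wt_transposeBox (b : lam.Box) : (lam.transposeBox b).wt = b.wt⁻¹ := by
  have h : (lam.transposeBox b).content = -b.content := by
    simp [Box.content, transposeBox]
  have h2 : (lam.transposeBox b).comp = b.comp := rfl
  rw [Box.wt, h, h2, Box.wt, mul_inv, zpow_neg]
  rcases uVal_cases b.comp with h3 | h3 <;> simp [h3]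

/-- Inverting the weights turns `α(b,c)` into `α(c,b)`, and the two add up to `q - 1`. This accounts
for the diagonal part of `♭`. -/
theorem alpha_transposeBox {b c : lam.Box} (h : b.wt ≠ c.wt) :
    (lam.transposeBox b).alpha (lam.transposeBox c) = qq - 1 - b.alpha c := by
  have hb := b.wt_ne_zero
  have hc := c.wt_ne_zero
  have h1 : c.wt - b.wt ≠ 0 := sub_ne_zero.mpr h.symm
  have h2 : b.wt - c.wt ≠ 0 := sub_ne_zero.mpr h
  rw [Box.alpha, Box.alpha, wt_transposeBox, wt_transposeBox, inv_sub_inv hc hb]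
  field_simp
  ring

theorem beta_transposeBox {b c : lam.Box} (h : b.wt ≠ c.wt) :
    (lam.transposeBox b).beta (lam.transposeBox c) =
      if b.SameRow c ∨ b.SameCol c then 0 else (qq * b.wt - c.wt) / (b.wt - c.wt) := by
  have hb := b.wt_ne_zero
  have hc := c.wt_ne_zero
  have h2 : b.wt - c.wt ≠ 0 := sub_ne_zero.mpr h
  have h3 : ((lam.transposeBox b).SameRow (lam.transposeBox c) ∨
      (lam.transposeBox b).SameCol (lam.transposeBox c)) ↔ (b.SameRow c ∨ b.SameCol c) :=
    or_comm
  simp only [Box.beta, h3, wt_transposeBox]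
  congr 1
  rw [inv_sub_inv hc hb]
  field_simp

/-! ### Nonvanishing of the rescaling factors -/

/-- An equality between signed powers of the indeterminate `q` forces equal exponents, then equal
signs; the sign determines the component. -/
theorem Box.of_qq_mul_wt_eq {b c : lam.Box} (h : qq * c.wt = b.wt) :
    b.comp = c.comp ∧ b.content = c.content + 1 := by
  have h' : qq ^ (c.content + 1) * uVal c.comp = uVal b.comp * qq ^ b.content := by
    rw [zpow_add_one₀ qq_ne_zero]
    rw [Box.wt, Box.wt] at h
    linear_combination h
  have hcont : c.content + 1 = b.content := by
    rcases uVal_cases b.comp with hb | hb <;> rcases uVal_cases c.comp with hc | hc <;>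
      rw [hb, hc] at h'
    · exact qq_zpow_inj (Or.inl rfl) (by linear_combination h')
    · exact qq_zpow_inj (Or.inr rfl) (by linear_combination -h')
    · exact qq_zpow_inj (Or.inr rfl) (by linear_combination h')
    · exact qq_zpow_inj (Or.inl rfl) (by linear_combination -h')
  refine ⟨?_, hcont.symm⟩
  rw [hcont, mul_comm] at h'
  have h2 := mul_right_cancel₀ (zpow_ne_zero _ qq_ne_zero) h'
  by_contra hne
  have h3 := (uVal_eq_or b.comp c.comp).resolve_left hne
  rw [h3] at h2
  rcases uVal_cases b.comp with hb | hb <;> rw [hb] at h2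
  · exact neg_one_ne_one_K1 h2
  · exact neg_one_ne_one_K1 (by simpa using h2.symm)

/-- Otherwise the box in the row of `b` and the column of `c` would carry a symbol strictly between
two consecutive ones. -/
theorem IsStandard.not_row_lt_and_col_lt {e : lam.Box ≃ Fin n} (he : IsStandard e)
    {b c : lam.Box} (h : (e c : ℕ) = e b + 1) (hcomp : b.comp = c.comp) :
    ¬ (b.row < c.row ∧ b.col < c.col) := by
  rintro ⟨hr, hc⟩
  let d : lam.Box := ⟨c.comp, b.row, c.col, (lam.shape c.comp).up_left_mem hr.le le_rfl c.mem⟩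
  have h1 : e b < e d := (he b d hcomp).1 rfl hc
  have h2 : e d < e c := (he d c rfl).2 rfl hr
  rw [Fin.lt_def] at h1 h2
  omega

theorem IsStandard.not_row_le_and_col_le {e : lam.Box ≃ Fin n} (he : IsStandard e)
    {b c : lam.Box} (h : (e c : ℕ) = e b + 1) (hcomp : b.comp = c.comp) :
    ¬ (c.row ≤ b.row ∧ c.col ≤ b.col) := by
  rintro ⟨hr, hc⟩
  have := he.lt hcomp.symm hr hc (by rintro rfl; omega)
  rw [Fin.lt_def] at this
  omega

/-- Either equality would put `b` and `c` in one diagram with contents differing by one. For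
consecutive symbols, `c` lies neither strictly below and to the right of `b` nor weakly above and to
the left of it, which leaves only a common column in the first case and a common row in the second.
-/
theorem IsStandard.qq_mul_wt_ne {e : lam.Box ≃ Fin n} (he : IsStandard e) {b c : lam.Box}
    (h : (e c : ℕ) = e b + 1) (hadj : ¬ (b.SameRow c ∨ b.SameCol c)) :
    qq * c.wt ≠ b.wt ∧ qq * b.wt ≠ c.wt := by
  constructor
  · intro hq
    obtain ⟨h1, h2⟩ := Box.of_qq_mul_wt_eq hq
    have h3 := he.not_row_lt_and_col_lt h h1
    have h4 := he.not_row_le_and_col_le h h1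
    simp only [Box.content] at h2
    exact hadj (Or.inr ⟨h1, by omega⟩)
  · intro hq
    obtain ⟨h1, h2⟩ := Box.of_qq_mul_wt_eq hq
    have h3 := he.not_row_lt_and_col_lt h h1.symm
    have h4 := he.not_row_le_and_col_le h h1.symm
    simp only [Box.content] at h2
    exact hadj (Or.inl ⟨h1.symm, by omega⟩)

/-! ### The rescaling factors -/

open Classical in
/-- The contribution to the rescaling of `v_T` of a box `b` that is filled before the box `c`. -/
noncomputable def Box.scale (b c : lam.Box) : K1 :=
  -- The value `1` only keeps the factor invertible: the intended factor can vanish, for instance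
  -- for vertical neighbours.
  if qq * c.wt = b.wt then 1 else qq * c.wt - b.wt

theorem Box.scale_ne_zero (b c : lam.Box) : b.scale c ≠ 0 := by
  unfold Box.scale
  split_ifs with h
  · exact one_ne_zero
  · exact sub_ne_zero.mpr h

/-- The factor by which `v_T` is rescaled in the passage from `λ` to `λ'`. -/
noncomputable def scale (e : lam.Box ≃ Fin n) : K1 :=
  ∏ p : Fin n × Fin n with p.1 < p.2, (e.symm p.1).scale (e.symm p.2)

theorem scale_ne_zero (e : lam.Box ≃ Fin n) : scale e ≠ 0 :=
  Finset.prod_ne_zero_iff.mpr fun _ _ => Box.scale_ne_zero _ _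

/-- Exchanging `i - 1` and `i` only affects one factor of the scale. -/
theorem scale_swapFilling (e : lam.Box ≃ Fin n) {i : Fin n} (hi : (i : ℕ) ≠ 0) :
    scale (swapFilling i e) * (e.symm (prevSymbol i)).scale (e.symm i) =
      scale e * (e.symm i).scale (e.symm (prevSymbol i)) := by
  have hmem : (prevSymbol i, i) ∈
      Finset.univ.filter (fun p : Fin n × Fin n => p.1 < p.2) := by
    simpa using prevSymbol_lt hi
  have hrest : ∏ p ∈ (Finset.univ.filter fun p : Fin n × Fin n => p.1 < p.2).erase
        (prevSymbol i, i), ((swapFilling i e).symm p.1).scale ((swapFilling i e).symm p.2) =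
      ∏ p ∈ (Finset.univ.filter fun p : Fin n × Fin n => p.1 < p.2).erase
        (prevSymbol i, i), (e.symm p.1).scale (e.symm p.2) := by
    -- The transposition, applied to both entries, permutes the ordered pairs other than `(i-1, i)`.
    -- Being an involution, it is its own inverse in the reindexing of the product.
    have hmaps : ∀ p ∈ (Finset.univ.filter fun p : Fin n × Fin n => p.1 < p.2).erase
        (prevSymbol i, i), Prod.map (Equiv.swap (prevSymbol i) i) (Equiv.swap (prevSymbol i) i) p ∈
          (Finset.univ.filter fun p : Fin n × Fin n => p.1 < p.2).erase (prevSymbol i, i) := by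
      rintro ⟨x, y⟩ hp
      simp only [Finset.mem_erase, Finset.mem_filter, Finset.mem_univ, true_and, ne_eq,
        Prod.mk.injEq, Prod.map_apply] at hp ⊢
      refine ⟨fun h => ?_, swap_prevSymbol_lt hp.2 hp.1⟩
      have hx : x = i := by rw [Equiv.swap_apply_eq_iff.1 h.1, Equiv.swap_apply_left]
      have hy : y = prevSymbol i := by
        rw [Equiv.swap_apply_eq_iff.1 h.2, Equiv.swap_apply_right]
      rw [hx, hy] at hp
      exact hp.2.asymm (prevSymbol_lt hi)
    refine Finset.prod_nbij' _ _ hmaps hmaps ?_ ?_ ?_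
    · rintro ⟨x, y⟩ _; simp
    · rintro ⟨x, y⟩ _; simp
    · rintro ⟨x, y⟩ _; simp [swapFilling_symm]
  rw [scale, scale, ← Finset.mul_prod_erase _ _ hmem, ← Finset.mul_prod_erase _ _ hmem, hrest,
    swapFilling_symm, swapFilling_symm, Equiv.swap_apply_left, Equiv.swap_apply_right]
  ring

/-- This compares the off-diagonal coefficients of `(q-1) - aᵢ` on `λ` and of `aᵢ` on `λ'`. The
ratio of the two scales is `(qb-c)/(qc-b)` in terms of the weights, exactly what turns `-β(b,c)`
into `β` of the transposed boxes. -/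
theorem IsStandard.beta_mul_scale_swapFilling {e : lam.Box ≃ Fin n} (he : IsStandard e)
    {i : Fin n} (hi : (i : ℕ) ≠ 0) :
    -((e.symm (prevSymbol i)).beta (e.symm i) * scale (swapFilling i e)) =
      scale e *
        (lam.transposeBox (e.symm (prevSymbol i))).beta (lam.transposeBox (e.symm i)) := by
  have hw := he.wt_ne (prevSymbol_lt hi) (by simp only [prevSymbol]; omega)
  have hsucc : (e (e.symm i) : ℕ) = e (e.symm (prevSymbol i)) + 1 := by
    simp only [Equiv.apply_symm_apply, prevSymbol]; omega
  have hs := scale_swapFilling e hi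
  rw [beta_transposeBox hw, Box.beta]
  split_ifs with hadj
  · simp
  -- Both factors in `scale_swapFilling` thus have their generic value, and the denominator of the
  -- ratio is nonzero.
  obtain ⟨h1, h2⟩ := he.qq_mul_wt_ne hsucc hadj
  rw [Box.scale, if_neg h1, Box.scale, if_neg h2] at hs
  have h3 := sub_ne_zero.mpr hw
  have h4 := sub_ne_zero.mpr hw.symm
  rw [← neg_sub (e.symm i).wt (e.symm (prevSymbol i)).wt]
  field_simp
  linear_combination -hs

/-- The twist is by `♭`, realised by `v_T ↦ scale T • v_{T'}`. -/
theorem repDagger_equivalent_transpose (lam : BiPartition n) :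
    RepEquivalent lam.repDagger lam.transpose.repDagger := by
  refine repDagger_equivalent_of_twist (HeckeB.flat n qq) (fun a ha => ha.1.2)
    (scaledEquiv lam.transposeBox isStandard_transpose scale scale_ne_zero) fun i v => ?_
  rw [HeckeB.flat, HeckeB.lift_gen]
  suffices h : (scaledEquiv lam.transposeBox isStandard_transpose scale
        scale_ne_zero).toLinearMap ∘ₗ
      lam.rep (if (i : ℕ) = 0 then HeckeB.gen 1 qq i else (qq - 1) • 1 - HeckeB.gen 1 qq i) =
      lam.transpose.genAction i ∘ₗ
        (scaledEquiv lam.transposeBox isStandard_transpose scale scale_ne_zero).toLinearMap from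
    LinearMap.congr_fun h v
  apply linearMap_ext_fvec
  intro e he
  simp only [LinearMap.comp_apply, LinearEquiv.coe_coe, scaledEquiv_fvec, map_smul]
  by_cases hi : (i : ℕ) = 0
  · rw [if_pos hi, rep_gen, genAction_zero hi, map_smul, scaledEquiv_fvec, genAction_zero hi,
      symm_trans_symm, smul_comm]
    rfl
  · have hw := he.wt_ne (prevSymbol_lt hi) (by simp only [prevSymbol]; omega)
    have hs := he.beta_mul_scale_swapFilling hi
    rw [if_neg hi, map_sub, map_smul, map_one, rep_gen, LinearMap.sub_apply,
      LinearMap.smul_apply, Module.End.one_apply, genAction_fvec he hi,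
      genAction_fvec ((isStandard_transpose e).1 he) hi, map_sub, map_add, map_smul, map_smul,
      map_smul, scaledEquiv_fvec, scaledEquiv_fvec, symm_trans_symm, symm_trans_symm,
      alpha_transposeBox hw, swapFilling_trans]
    -- The diagonal terms already agree by `alpha_transposeBox`; `hs` settles the coefficient of the
    -- exchanged tableau.
    linear_combination (norm := module)
      hs • fvec (lam.transposeBox.symm.trans (swapFilling i e))

end BiPartition

theorem proposition7p1 (n : ℕ) (hn : 4 ≤ n) (lam : BiPartition n) :
    RepEquivalent lam.repDagger lam.star.repDagger ∧
      RepEquivalent lam.star.repDagger lam.transpose.repDagger ∧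
      RepEquivalent lam.transpose.repDagger lam.transpose.star.repDagger :=
  ⟨lam.repDagger_equivalent_star,
    -- The passage from `λ*` to `λ'` goes through `λ`.
    lam.repDagger_equivalent_star.symm.trans lam.repDagger_equivalent_transpose,
    lam.transpose.repDagger_equivalent_star⟩
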